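/- Let $s\ge 3$, let $P=(p_1,\dots,p_s)$ be a convex polygon in the plane with vertices listed in cyclic order, let $B$ be a finite set of (blue) points in the interior of $P$ and $R$ a finite set of (red) points outside $P$, such that $s=|B|-|R|$ and $R\cup B\cup\{p_1,\dots,p_s\}$ is in general position (no three of its points are collinear). Then there is a partition of the plane into convex polygonal regions $Q_1,\dots,Q_s$ and an assignment of every point of $R\cup B$ to exactly one of the regions $Q_i$ containing it, such that for every $i$ (indices modulo $s$) the segment $p_ip_{i+1}$ is a diagonal of $Q_i$, and the number of blue points assigned to $Q_i$ minus the number of red points assigned to $Q_i$ equals $1$. Here a convex polygonal region is a closed, possibly unbounded, convex set with nonempty interior that is an intersection of finitely many closed half-planes (possibly of none, i.e. the whole plane) and whose boundary is empty or a single polygonal chain (connected); a partition of the plane into regions means that the regions cover the plane and have pairwise disjoint interiors; a diagonal of a region is a segment joining two distinct points of its boundary. -/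

import Mathlib

/-- The Euclidean plane. -/
abbrev Plane : Type := EuclideanSpace ℝ (Fin 2)

/-- Twice the signed area of the triangle `abc`: positive if `c` lies strictly to the left of the
directed line from `a` to `b`, negative if strictly to the right, zero if `c` lies on it
(or `a = b`). -/
def orient (a b c : Plane) : ℝ :=
  (b 0 - a 0) * (c 1 - a 1) - (b 1 - a 1) * (c 0 - a 0)

/-- No three distinct points of `S` are collinear. -/
def InGeneralPosition (S : Set Plane) : Prop :=
  ∀ a ∈ S, ∀ b ∈ S, ∀ c ∈ S, a ≠ b → a ≠ c → b ≠ c → ¬ Collinear ℝ {a, b, c}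

/-- The vertices `P 0, …, P (s - 1)` are, in this cyclic order (clockwise or counterclockwise),
the corners of a (strictly) convex polygon: all vertices other than the ends of an edge lie
strictly on one side of that edge. Indices are modulo `s`. -/
def IsConvexPolygon {s : ℕ} [NeZero s] (P : Polygon Plane s) : Prop :=
  3 ≤ s ∧
    ((∀ i j : Fin s, j ≠ i → j ≠ i + 1 → orient (P i) (P (i + 1)) (P j) < 0) ∨
     (∀ i j : Fin s, j ≠ i → j ≠ i + 1 → 0 < orient (P i) (P (i + 1)) (P j)))

/-- The closed convex region (boundary and interior) enclosed by a convex polygon. -/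
def polygonBody {s : ℕ} (P : Polygon Plane s) : Set Plane :=
  convexHull ℝ (Set.range P.vertices)

/-- A convex polygonal region: an intersection of finitely many closed half-planes, possibly
unbounded (the whole plane is allowed), with nonempty interior, and whose boundary, if not empty,
is a single polygonal chain, that is, connected (so an infinite strip is not allowed). -/
def IsConvexPolygonalRegion (Q : Set Plane) : Prop :=
  (∃ (n : ℕ) (a : Fin n → Plane) (c : Fin n → ℝ), Q = {x | ∀ k, inner ℝ (a k) x ≤ c k}) ∧
    (interior Q).Nonempty ∧ IsPreconnected (frontier Q)

/-- The regions `Q i` partition the plane: they cover it and their interiors are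
pairwise disjoint. -/
def IsPlanePartition {s : ℕ} (Q : Fin s → Set Plane) : Prop :=
  (⋃ i, Q i) = Set.univ ∧ ∀ i j, i ≠ j → Disjoint (interior (Q i)) (interior (Q j))

/-- The segment `ab` is a diagonal of the region `Q`: it joins two distinct boundary points. -/
def IsDiagonal (Q : Set Plane) (a b : Plane) : Prop :=
  a ≠ b ∧ a ∈ frontier Q ∧ b ∈ frontier Q

/-!
Let `l i` be an affine form that vanishes on the line of the `i`-th edge and is positive at the other
vertices. For positive weights `w`, the cells `Q i = {x | ∀ j, w i * l i x ≤ w j * l j x}` of the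
concave function `min_j (w j * l j)` form a partition of the plane into convex polygonal regions, and
`Q i` has the `i`-th edge as a diagonal: on this edge the `i`-th form is zero and the others are
nonnegative. A cell contains no line, so its boundary is connected
(`isPreconnected_frontier_of_no_line`).

It remains to choose the weights. When `w i` grows, the cell `Q i` shrinks inside the polygon, where
all forms are positive, and grows outside, where the minimum is negative; so its number of blue points
minus its number of red points decreases. Accordingly, in terms of `log w` the balance condition is
the optimality condition of a concave maximization problem, the dual of an assignment problem
between the blue points on one side and the edges together with the red points on the other. Integral
duality (`exists_equiv_dual_potential`, via compactness and Hall's theorem) gives the weights and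
resolves the ties between cells (`exists_signed_allocation`).
-/

/-! ### Potentials and signed allocations -/

/-- The dual objective of the assignment problem with cost matrix `C` attains its maximum: it is
invariant under constant shifts and tends to `-∞` modulo shifts. -/
theorem exists_forall_dual_le {β τ : Type*} [Fintype β] [Fintype τ] [Nonempty τ]
    (hcard : Fintype.card β = Fintype.card τ) (C : β → τ → ℝ) :
    ∃ v : τ → ℝ, ∀ v' : τ → ℝ,
      ∑ b, Finset.univ.inf' Finset.univ_nonempty (fun t => C b t - v' t) + ∑ t, v' t ≤
      ∑ b, Finset.univ.inf' Finset.univ_nonempty (fun t => C b t - v t) + ∑ t, v t := by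
  classical
  set F : (τ → ℝ) → ℝ := fun v =>
    ∑ b, Finset.univ.inf' Finset.univ_nonempty (fun t => C b t - v t) + ∑ t, v t with hF
  change ∃ v, ∀ v', F v' ≤ F v
  have hcont : Continuous F := by
    refine Continuous.add (continuous_finsetSum _ fun b _ => ?_) (by fun_prop)
    refine Continuous.finset_inf'_apply _ fun t _ => ?_
    fun_prop
  obtain ⟨A, hA⟩ : ∃ A, ∀ b t, C b t ≤ A := by
    obtain ⟨A, hA⟩ := (Set.finite_range (fun q : β × τ => C q.1 q.2)).bddAbove
    exact ⟨A, fun b t => hA ⟨(b, t), rfl⟩⟩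
  have hshift : ∀ v a, F (fun t => v t - a) = F v := by
    intro v a
    have h1 : ∀ b, Finset.univ.inf' Finset.univ_nonempty (fun t => C b t - (v t - a)) =
        Finset.univ.inf' Finset.univ_nonempty (fun t => C b t - v t) + a := by
      intro b
      apply le_antisymm
      · rw [← sub_le_iff_le_add]
        refine Finset.le_inf' _ _ fun t ht => ?_
        have := Finset.inf'_le (fun t => C b t - (v t - a)) ht
        linarith
      · refine Finset.le_inf' _ _ fun t ht => ?_
        have := Finset.inf'_le (fun t => C b t - v t) ht
        linarith
    simp only [hF, h1, Finset.sum_add_distrib, Finset.sum_sub_distrib, Finset.sum_const,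
      Finset.card_univ, hcard]
    ring
  set M : ℝ := Fintype.card β * A - F 0
  -- After a shift making the largest potential zero, `F v ≤ card β * A + min v`.
  have hbound : ∀ v : τ → ℝ, (∀ t, v t ≤ 0) → (∃ t, v t = 0) →
      ∀ t, F v ≤ Fintype.card β * A + v t := by
    rintro v hv ⟨t₀, ht₀⟩ t
    have h1 : ∑ b, Finset.univ.inf' Finset.univ_nonempty (fun t => C b t - v t) ≤
        Fintype.card β * A := by
      calc _ ≤ ∑ b : β, A := by
            refine Finset.sum_le_sum fun b _ => ?_
            refine (Finset.inf'_le _ (Finset.mem_univ t₀)).trans ?_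
            rw [ht₀, sub_zero]; exact hA b t₀
        _ = _ := by simp
    have h2 : ∑ t, v t ≤ v t := by
      rw [← Finset.add_sum_erase _ _ (Finset.mem_univ t)]
      have : ∑ t ∈ Finset.univ.erase t, v t ≤ 0 := Finset.sum_nonpos fun i _ => hv i
      linarith
    simp only [hF]; linarith
  have hM : 0 ≤ M := by
    have := hbound 0 (by simp) ⟨Classical.arbitrary τ, rfl⟩ (Classical.arbitrary τ)
    simp only [Pi.zero_apply] at this
    simp only [M]; linarith
  have hcpt : IsCompact (Set.Icc (fun _ : τ => -M) 0) := isCompact_Icc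
  have h0 : (0 : τ → ℝ) ∈ Set.Icc (fun _ : τ => -M) 0 := ⟨fun t => by simpa using hM, le_rfl⟩
  obtain ⟨v, -, hv⟩ := hcpt.exists_isMaxOn ⟨0, h0⟩ hcont.continuousOn
  refine ⟨v, fun v' => ?_⟩
  obtain ⟨t₀, -, ht₀⟩ := Finset.exists_max_image Finset.univ v' Finset.univ_nonempty
  rw [← hshift v' (v' t₀)]
  by_cases hin : (fun t => v' t - v' t₀) ∈ Set.Icc (fun _ : τ => -M) 0
  · exact hv hin
  · have hle : ∀ t, v' t - v' t₀ ≤ 0 := fun t => by linarith [ht₀ t (Finset.mem_univ t)]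
    obtain ⟨t, ht⟩ : ∃ t, v' t - v' t₀ < -M := by
      by_contra! h
      exact hin ⟨fun t => h t, fun t => hle t⟩
    have h1 := hbound _ hle ⟨t₀, sub_self _⟩ t
    have h2 : F 0 ≤ F v := hv h0
    simp only [M] at ht
    linarith

open Filter Topology in
/-- Duality for the assignment problem. At a maximum of the dual objective, Hall's condition holds for
the pairs `(b, t)` where `C b t - v t` is minimal in `t`, which gives a perfect matching. -/
theorem exists_equiv_dual_potential {β τ : Type*} [Fintype β] [Fintype τ] [Nonempty τ]
    (hcard : Fintype.card β = Fintype.card τ) (C : β → τ → ℝ) :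
    ∃ (σ : β ≃ τ) (v : τ → ℝ), ∀ b t, C b (σ b) - v (σ b) ≤ C b t - v t := by
  classical
  obtain ⟨v, hv⟩ := exists_forall_dual_le hcard C
  set m : β → ℝ := fun b => Finset.univ.inf' Finset.univ_nonempty (fun t => C b t - v t) with hm
  have hmle : ∀ b t, m b ≤ C b t - v t := fun b t => Finset.inf'_le _ (Finset.mem_univ t)
  let tight : β → Finset τ := fun b => Finset.univ.filter fun t => C b t - v t = m b
  have hall : ∀ S : Finset β, S.card ≤ (S.biUnion tight).card := by
    intro S
    by_contra! hS
    set N := S.biUnion tight with hN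
    have hslack : ∀ b ∈ S, ∀ t ∉ N, m b < C b t - v t := by
      intro b hb t ht
      refine lt_of_le_of_ne (hmle b t) fun h => ht ?_
      exact Finset.mem_biUnion.2 ⟨b, hb, by simp [tight, h]⟩
    obtain ⟨ε, hε, hεpos⟩ : ∃ ε : ℝ, (∀ b t, b ∈ S → t ∉ N → m b + ε < C b t - v t) ∧ 0 < ε := by
      have : ∀ᶠ ε in 𝓝[>] (0 : ℝ), ∀ b t, b ∈ S → t ∉ N → m b + ε < C b t - v t := by
        refine eventually_all.2 fun b => eventually_all.2 fun t => ?_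
        by_cases hb : b ∈ S
        · by_cases ht : t ∈ N
          · simp [ht]
          · have h := sub_pos.2 (hslack b hb t ht)
            filter_upwards [Ioo_mem_nhdsGT h] with ε hε _ _
            linarith [hε.2]
        · simp [hb]
      exact (this.and self_mem_nhdsWithin).exists
    -- Lowering the potentials on the neighbourhood `N` by `ε` would increase the dual objective.
    have key := hv fun t => v t - if t ∈ N then ε else 0
    have h1 : ∀ b, m b + (if b ∈ S then ε else 0) ≤
        Finset.univ.inf' Finset.univ_nonempty
          (fun t => C b t - (v t - if t ∈ N then ε else 0)) := by
      intro b
      refine Finset.le_inf' _ _ fun t _ => ?_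
      have := hmle b t
      split_ifs with hb ht ht
      · linarith
      · linarith [hε b t hb ht]
      · linarith
      · linarith
    have h2 := Finset.sum_le_sum fun b (_ : b ∈ Finset.univ) => h1 b
    simp only [Finset.sum_add_distrib, Finset.sum_sub_distrib, Finset.sum_ite_mem,
      Finset.univ_inter, Finset.sum_const, nsmul_eq_mul] at h2 key
    have h3 : (N.card : ℝ) + 1 ≤ S.card := by exact_mod_cast hS
    have h4 : ∑ b, m b =
      ∑ b, Finset.univ.inf' Finset.univ_nonempty (fun t => C b t - v t) := rfl
    nlinarith
  obtain ⟨f, hf, hft⟩ := (Finset.all_card_le_biUnion_card_iff_exists_injective tight).1 hall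
  refine ⟨Equiv.ofBijective f ((Fintype.bijective_iff_injective_and_card f).2 ⟨hf, hcard⟩), v,
    fun b t => ?_⟩
  have := hft b
  simp only [tight, Finset.mem_filter, Finset.mem_univ, true_and] at this
  simpa [this] using hmle b t

/-- Think of `L b i` and `M r i` as the values of the `i`-th edge form at the blue point `b` and the
red point `r`. There are positive weights `w`, and a choice for each point of an index minimizing the
weighted value, such that each index is chosen by exactly one more blue point than red points.

Logarithms turn this into an assignment problem: each blue point is matched to an index or to a red
point, and a blue and a red point that are matched share the cheapest index at which the red point
has a negative value. -/
theorem exists_signed_allocation {ι β ρ : Type*} [Fintype ι] [Nonempty ι] [Fintype β] [Fintype ρ]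
    [DecidableEq ι]
    (hcard : Fintype.card β = Fintype.card ι + Fintype.card ρ)
    (L : β → ι → ℝ) (hL : ∀ b i, 0 < L b i) (M : ρ → ι → ℝ) (hM : ∀ r, ∃ i, M r i < 0) :
    ∃ (w : ι → ℝ) (f : β → ι) (g : ρ → ι), (∀ i, 0 < w i) ∧
      (∀ b j, w (f b) * L b (f b) ≤ w j * L b j) ∧
      (∀ r j, w (g r) * M r (g r) ≤ w j * M r j) ∧
      ∀ i, Fintype.card {b // f b = i} = Fintype.card {r // g r = i} + 1 := by
  classical
  have hmin : ∀ b r, ∃ i, M r i < 0 ∧ ∀ j, M r j < 0 →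
      Real.log (L b i) - Real.log (-M r i) ≤ Real.log (L b j) - Real.log (-M r j) := by
    intro b r
    obtain ⟨i₀, hi₀⟩ := hM r
    obtain ⟨i, hi, h⟩ := Finset.exists_min_image (Finset.univ.filter fun i => M r i < 0)
      (fun i => Real.log (L b i) - Real.log (-M r i)) ⟨i₀, by simpa using hi₀⟩
    exact ⟨i, by simpa using hi, fun j hj => h j (by simpa using hj)⟩
  choose k hkneg hkmin using hmin
  let C : β → ι ⊕ ρ → ℝ := fun b => Sum.elim (fun i => Real.log (L b i))
    (fun r => Real.log (L b (k b r)) - Real.log (-M r (k b r)))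
  obtain ⟨σ, v, hv⟩ := exists_equiv_dual_potential (by simpa using hcard) C
  let u : ι → ℝ := fun i => -v (Sum.inl i)
  let g : ρ → ι := fun r => k (σ.symm (Sum.inr r)) r
  let f : β → ι := fun b => Sum.elim id g (σ b)
  -- Optimality of the match of the index `i` itself bounds `u i` by the potential of `r`.
  have hu : ∀ r i, M r i < 0 → u i + Real.log (-M r i) ≤ -v (Sum.inr r) := by
    intro r i hi
    have h := hv (σ.symm (Sum.inl i)) (Sum.inr r)
    have h' := hkmin (σ.symm (Sum.inl i)) r i hi
    simp only [C, Equiv.apply_symm_apply, Sum.elim_inl, Sum.elim_inr] at h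
    simp only [u]; linarith
  have hlog : ∀ x y a b : ℝ, 0 < x → 0 < y → a + Real.log x ≤ b + Real.log y →
      Real.exp a * x ≤ Real.exp b * y := by
    intro x y a b hx hy h
    have := Real.exp_le_exp.2 h
    rwa [Real.exp_add, Real.exp_add, Real.exp_log hx, Real.exp_log hy] at this
  have hred : ∀ r, u (g r) + Real.log (-M r (g r)) = -v (Sum.inr r) := by
    intro r
    refine le_antisymm (hu r _ (hkneg _ _)) ?_
    have h := hv (σ.symm (Sum.inr r)) (Sum.inl (g r))
    simp only [C, Equiv.apply_symm_apply, Sum.elim_inl, Sum.elim_inr] at h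
    simp only [u, g] at h ⊢; linarith
  refine ⟨fun i => Real.exp (u i), f, g, fun i => Real.exp_pos _, fun b j => ?_, fun r j => ?_,
    fun i => ?_⟩
  · refine hlog _ _ _ _ (hL _ _) (hL _ _) ?_
    have h := hv b (Sum.inl j)
    rcases hb : σ b with i | r
    · simp only [hb, C, Sum.elim_inl] at h
      simp only [f, hb, Sum.elim_inl, id, u]; linarith
    · have hbr : σ.symm (Sum.inr r) = b := by rw [← hb, Equiv.symm_apply_apply]
      have h1 := hred r
      simp only [g, hbr] at h1
      simp only [hb, C, Sum.elim_inl, Sum.elim_inr] at h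
      simp only [f, hb, Sum.elim_inr, g, hbr]
      simp only [u] at h1 ⊢; linarith
  · have hg : M r (g r) < 0 := hkneg _ _
    by_cases hj : M r j < 0
    · have := hlog (-M r j) (-M r (g r)) (u j) (u (g r)) (by linarith) (by linarith)
        ((hu r j hj).trans (hred r).ge)
      linarith
    · push Not at hj
      have h1 := mul_neg_of_pos_of_neg (Real.exp_pos (u (g r))) hg
      have h2 := mul_nonneg (Real.exp_pos (u j)).le hj
      linarith
  · have e : {b // f b = i} ≃ {t : ι ⊕ ρ // Sum.elim id g t = i} :=
      σ.subtypeEquiv fun b => Iff.rfl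
    rw [Fintype.card_congr (e.trans (Equiv.subtypeSum)), Fintype.card_sum, add_comm]
    congr 1
    exact Fintype.card_eq_one_iff.2 ⟨⟨i, rfl⟩, fun a => Subtype.ext a.2⟩


/-! ### Convex sets and affine forms -/

/-- Radial projection maps the complement of the recession cone `{gauge K = 0}` onto the frontier.
Since `K` contains no line through `0`, the cone contains no opposite nonzero vectors, and its
complement is connected. -/
theorem isPreconnected_frontier_of_zero_mem {E : Type*} [NormedAddCommGroup E] [NormedSpace ℝ E]
    (hE : 1 < Module.rank ℝ E) {K : Set E} (hK : Convex ℝ K) (h0 : K ∈ nhds 0)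
    (hline : ∀ u : E, u ≠ 0 → ∃ t : ℝ, t • u ∉ K) : IsPreconnected (frontier K) := by
  have habs := absorbent_nhds_zero (𝕜 := ℝ) h0
  have hcont := continuous_gauge hK h0
  have hray : ∀ v, gauge K v = 0 → ∀ t : ℝ, 0 ≤ t → t • v ∈ K := by
    intro v hv t ht
    apply setOfPred_gauge_lt_one_subset_self hK (mem_of_mem_nhds h0) habs
    rw [Set.mem_ofPred_eq, gauge_smul_of_nonneg ht, hv]
    simp
  have hne : ∀ u, u ≠ 0 → gauge K u = 0 → gauge K (-u) ≠ 0 := by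
    intro u hu h1 h2
    obtain ⟨t, ht⟩ := hline u hu
    rcases le_total 0 t with h | h
    · exact ht (hray u h1 t h)
    · have := hray (-u) h2 (-t) (by linarith)
      simp only [smul_neg, neg_smul, neg_neg] at this
      exact ht this
  have hpos : IsPreconnected {v | gauge K v ≠ 0} := by
    by_cases hu : ∃ u, u ≠ 0 ∧ gauge K u = 0
    · obtain ⟨u, hu, hu0⟩ := hu
      -- The directions outside the recession cone are star-shaped around `-u`.
      have hstar : StarConvex ℝ (-u) {v | gauge K v ≠ 0} := by
        intro v hv a b ha hb hab h
        rcases hb.eq_or_lt with rfl | hb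
        · obtain rfl : a = 1 := by linarith
          simp only [one_smul, zero_smul, add_zero] at h
          exact hne u hu hu0 h
        · have h1 := gauge_add_le hK habs (a • -u + b • v) (a • u)
          have h2 : a • -u + b • v + a • u = b • v := by simp
          rw [h2, h, gauge_smul_of_nonneg ha, gauge_smul_of_nonneg hb.le, hu0] at h1
          simp only [smul_eq_mul, mul_zero, add_zero] at h1
          have h3 : 0 < gauge K v := lt_of_le_of_ne (gauge_nonneg v) (Ne.symm hv)
          nlinarith
      exact (hstar.isPathConnected (hne u hu hu0)).isConnected.isPreconnected
    · push Not at hu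
      have : {v | gauge K v ≠ 0} = {(0 : E)}ᶜ := by
        ext v
        refine ⟨?_, fun h => hu v h⟩
        rintro h rfl
        exact h gauge_zero
      rw [this]
      exact (isConnected_compl_singleton_of_one_lt_rank hE 0).isPreconnected
  have himg : frontier K = (fun v => (gauge K v)⁻¹ • v) '' {v | gauge K v ≠ 0} := by
    ext x
    rw [← gauge_eq_one_iff_mem_frontier hK h0]
    constructor
    · intro h
      exact ⟨x, by simp [h], by simp [h]⟩
    · rintro ⟨v, hv, rfl⟩
      rw [gauge_smul_of_nonneg (inv_nonneg.2 (gauge_nonneg v))]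
      exact inv_mul_cancel₀ hv
  rw [himg]
  exact hpos.image _ ((hcont.continuousOn.inv₀ fun v hv => hv).smul continuousOn_id)

/-- A convex set with an interior point `o` that contains no line through `o` has a connected
frontier (in dimension at least two). -/
theorem isPreconnected_frontier_of_no_line {E : Type*} [NormedAddCommGroup E] [NormedSpace ℝ E]
    (hE : 1 < Module.rank ℝ E) {K : Set E} (hK : Convex ℝ K) {o : E} (ho : o ∈ interior K)
    (hline : ∀ u : E, u ≠ 0 → ∃ t : ℝ, o + t • u ∉ K) : IsPreconnected (frontier K) := by
  have h := isPreconnected_frontier_of_zero_mem (K := (Homeomorph.addLeft o) ⁻¹' K) hE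
    (hK.translate_preimage_right o)
    ((Homeomorph.addLeft o).continuous.continuousAt.preimage_mem_nhds
      (by simpa using mem_interior_iff_mem_nhds.1 ho)) hline
  rw [← (Homeomorph.addLeft o).preimage_frontier] at h
  have := h.image (Homeomorph.addLeft o) (Homeomorph.continuous _).continuousOn
  rwa [Set.image_preimage_eq _ (Homeomorph.surjective _)] at this

/-- An affine form that is nonnegative on `S` and positive somewhere has no zero in the interior
of `S`. -/
theorem AffineMap.pos_of_mem_interior {E : Type*} [NormedAddCommGroup E] [NormedSpace ℝ E]
    (f : E →ᵃ[ℝ] ℝ) {S : Set E} (hS : ∀ x ∈ S, 0 ≤ f x) {y : E} (hy : 0 < f y) {x : E}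
    (hx : x ∈ interior S) : 0 < f x := by
  have hcont : Continuous fun t : ℝ => AffineMap.lineMap x y t := AffineMap.lineMap_continuous
  have h0 : ∀ᶠ t in nhds (0 : ℝ), AffineMap.lineMap x y t ∈ S :=
    hcont.continuousAt.eventually (by simpa using mem_interior_iff_mem_nhds.1 hx)
  obtain ⟨t, htS, ht⟩ := ((h0.filter_mono nhdsWithin_le_nhds).and
    (self_mem_nhdsWithin (s := Set.Iio (0 : ℝ)))).exists
  -- Beyond `x`, seen from `y`, the form `f` would be negative if it vanished at `x`.
  have h := hS _ htS
  rw [AffineMap.apply_lineMap, AffineMap.lineMap_apply_module, smul_eq_mul, smul_eq_mul] at h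
  have ht : t < 0 := ht
  nlinarith

theorem AffineMap.exists_inner_add_eq (f : Plane →ᵃ[ℝ] ℝ) :
    ∃ (a : Plane) (c : ℝ), ∀ x, f x = inner ℝ a x + c := by
  refine ⟨(InnerProductSpace.toDual ℝ Plane).symm f.linear.toContinuousLinearMap, f 0,
    fun x => ?_⟩
  rw [InnerProductSpace.toDual_symm_apply]
  simpa using congrFun f.decomp x

/-! ### Cyclic indices -/

theorem Fin.val_add_one_eq_ite {s : ℕ} [NeZero s] (hs : 2 ≤ s) (i : Fin s) :
    (i + 1).val = if i.val + 1 = s then 0 else i.val + 1 := by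
  have hi := i.isLt
  rw [Fin.val_add, Fin.val_one', Nat.mod_eq_of_lt (show 1 < s by omega)]
  split_ifs with h
  · rw [h, Nat.mod_self]
  · exact Nat.mod_eq_of_lt (by omega)

theorem Fin.add_one_ne_self {s : ℕ} [NeZero s] (hs : 2 ≤ s) (i : Fin s) : i + 1 ≠ i := by
  intro h
  have := Fin.val_add_one_eq_ite hs i
  rw [h] at this
  split_ifs at this <;> omega

theorem Fin.add_one_add_one_ne_self {s : ℕ} [NeZero s] (hs : 3 ≤ s) (i : Fin s) :
    i + 1 + 1 ≠ i := by
  intro h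
  have h1 := Fin.val_add_one_eq_ite (by omega) i
  have h2 := Fin.val_add_one_eq_ite (by omega) (i + 1)
  rw [h] at h2
  split_ifs at h1 h2 <;> omega

theorem Fin.exists_add_one_eq {s : ℕ} [NeZero s] (i : Fin s) : ∃ j : Fin s, j + 1 = i :=
  ⟨i - 1, by simp⟩

/-! ### Cells of the minimum of affine forms attached to the edges -/

theorem exists_notMem_polygonBody {s : ℕ} (P : Polygon Plane s) (p : Plane) {u : Plane}
    (hu : u ≠ 0) : ∃ t : ℝ, 0 ≤ t ∧ p + t • u ∉ polygonBody P := by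
  have hb : Bornology.IsBounded (polygonBody P) :=
    isBounded_convexHull.2 (Set.finite_range _).isBounded
  obtain ⟨C, hC⟩ := hb.exists_norm_le
  have hu' : 0 < ‖u‖ := norm_pos_iff.2 hu
  refine ⟨(|C| + ‖p‖ + 1) / ‖u‖, by positivity, fun hmem => ?_⟩
  have h1 := hC _ hmem
  have h2 : ‖((|C| + ‖p‖ + 1) / ‖u‖) • u‖ = |C| + ‖p‖ + 1 := by
    rw [norm_smul, Real.norm_of_nonneg (by positivity), div_mul_cancel₀ _ hu'.ne']
  have h3 := norm_sub_le (p + ((|C| + ‖p‖ + 1) / ‖u‖) • u) p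
  rw [add_sub_cancel_left, h2] at h3
  linarith [le_abs_self C]

/-- Affine forms attached to the edges of a polygon: the `i`-th one vanishes at the ends of the
`i`-th edge and is positive at the other vertices, and the body of the polygon contains every
point where all the forms are nonnegative. -/
structure IsEdgeForms {s : ℕ} [NeZero s] (P : Polygon Plane s) (l : Fin s → Plane →ᵃ[ℝ] ℝ) :
    Prop where
  left (i : Fin s) : l i (P i) = 0
  right (i : Fin s) : l i (P (i + 1)) = 0
  pos (i j : Fin s) : j ≠ i → j ≠ i + 1 → 0 < l i (P j)
  mem_body (x : Plane) : (∀ i, 0 ≤ l i x) → x ∈ polygonBody P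

/-- The region where the `i`-th of finitely many affine forms is the smallest one. -/
def minCell {s : ℕ} (l : Fin s → Plane →ᵃ[ℝ] ℝ) (i : Fin s) : Set Plane :=
  {x | ∀ j, l i x ≤ l j x}

/-- The `i`-th and the `k`-th form agree at `p`, and their difference changes sign there on the
line `pq`. -/
theorem mem_frontier_minCell {s : ℕ} {l : Fin s → Plane →ᵃ[ℝ] ℝ} {i k : Fin s} {p q : Plane}
    (hp : ∀ j, 0 ≤ l j p) (hip : l i p = 0) (hkp : l k p = 0) (hkq : l k q = 0)
    (hiq : 0 < l i q) : p ∈ frontier (minCell l i) := by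
  refine ⟨subset_closure fun j => by rw [hip]; exact hp j, fun hint => ?_⟩
  have h1 := (l k - l i).pos_of_mem_interior (S := minCell l i) (fun y hy => by simpa using hy k)
    (y := AffineMap.lineMap p q (-1 : ℝ))
    (by
      rw [AffineMap.apply_lineMap, AffineMap.lineMap_apply_module]
      simp [hip, hkp, hkq, hiq]) hint
  simp [hip, hkp] at h1

namespace IsEdgeForms

variable {s : ℕ} [NeZero s] {P : Polygon Plane s} {l : Fin s → Plane →ᵃ[ℝ] ℝ}

theorem smul (h : IsEdgeForms P l) {w : Fin s → ℝ} (hw : ∀ i, 0 < w i) :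
    IsEdgeForms P fun i => w i • l i where
  left i := by simp [h.left]
  right i := by simp [h.right]
  pos i j h1 h2 := by simpa using mul_pos (hw i) (h.pos i j h1 h2)
  mem_body x hx := h.mem_body x fun i => by
    have := hx i
    simp only [AffineMap.coe_smul, Pi.smul_apply, smul_eq_mul] at this
    exact nonneg_of_mul_nonneg_right this (hw i)

theorem nonneg_vertex (h : IsEdgeForms P l) (i j : Fin s) : 0 ≤ l i (P j) := by
  by_cases h1 : j = i
  · rw [h1, h.left]
  by_cases h2 : j = i + 1
  · rw [h2, h.right]
  exact (h.pos i j h1 h2).le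

theorem nonneg_of_mem_body (h : IsEdgeForms P l) (i : Fin s) {x : Plane}
    (hx : x ∈ polygonBody P) : 0 ≤ l i x := by
  have hconv : Convex ℝ {x | 0 ≤ l i x} := (convex_Ici (0 : ℝ)).affine_preimage (l i)
  refine convexHull_min ?_ hconv hx
  rintro _ ⟨j, rfl⟩
  exact h.nonneg_vertex i j

theorem exists_pos (h : IsEdgeForms P l) (hs : 3 ≤ s) (i : Fin s) : 0 < l i (P (i + 1 + 1)) :=
  h.pos i _ (Fin.add_one_add_one_ne_self hs i) (Fin.add_one_ne_self (by omega) _)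

theorem pos_of_mem_interior (h : IsEdgeForms P l) (hs : 3 ≤ s) (i : Fin s) {x : Plane}
    (hx : x ∈ interior (polygonBody P)) : 0 < l i x :=
  (l i).pos_of_mem_interior (fun _ hy => h.nonneg_of_mem_body i hy) (h.exists_pos hs i) hx

theorem midpoint_eq_zero (h : IsEdgeForms P l) (i : Fin s) :
    l i (midpoint ℝ (P i) (P (i + 1))) = 0 := by
  rw [AffineMap.map_midpoint, h.left, h.right, midpoint_self]

theorem midpoint_pos (h : IsEdgeForms P l) (hs : 3 ≤ s) {i j : Fin s} (hij : j ≠ i) :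
    0 < l j (midpoint ℝ (P i) (P (i + 1))) := by
  have h1 := h.nonneg_vertex j i
  have h2 := h.nonneg_vertex j (i + 1)
  rw [AffineMap.map_midpoint, midpoint_eq_smul_add]
  have : 0 < l j (P i) + l j (P (i + 1)) := by
    by_cases h3 : i = j + 1
    · have := h.pos j (i + 1) (by rw [h3]; exact Fin.add_one_add_one_ne_self hs j)
        (by rw [h3]; exact Fin.add_one_ne_self (by omega) _)
      linarith
    · have := h.pos j i hij.symm h3
      linarith
  simpa using this

/-- In the interior of a cell the minimum is attained by one form only; at the midpoint of the
`i`-th edge the `i`-th form is strictly below the others. -/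
theorem lt_of_mem_interior_minCell (h : IsEdgeForms P l) (hs : 3 ≤ s) {i j : Fin s}
    (hij : j ≠ i) {x : Plane} (hx : x ∈ interior (minCell l i)) : l i x < l j x := by
  have := (l j - l i).pos_of_mem_interior (S := minCell l i)
    (fun y hy => by simpa using hy j) (y := midpoint ℝ (P i) (P (i + 1)))
    (by simpa [-AffineMap.map_midpoint, h.midpoint_eq_zero] using h.midpoint_pos hs hij) hx
  simpa using this

theorem midpoint_mem_interior_minCell (h : IsEdgeForms P l) (hs : 3 ≤ s) (i : Fin s) :
    midpoint ℝ (P i) (P (i + 1)) ∈ interior (minCell l i) := by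
  rw [mem_interior_iff_mem_nhds]
  refine Filter.eventually_all.2 fun j => ?_
  by_cases hij : j = i
  · subst hij; simp
  · have h1 : l i (midpoint ℝ (P i) (P (i + 1))) < l j (midpoint ℝ (P i) (P (i + 1))) := by
      rw [h.midpoint_eq_zero]; exact h.midpoint_pos hs hij
    filter_upwards [((l i).continuous_of_finiteDimensional.continuousAt).eventually_lt
      ((l j).continuous_of_finiteDimensional.continuousAt) h1] with x hx using hx.le

/-- A cell contains no line: all the forms would have the same slope along it, and a ray of that
direction starting at a vertex would stay in the bounded body of the polygon. -/
theorem exists_notMem_minCell (h : IsEdgeForms P l) (i : Fin s) (o : Plane) {u : Plane}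
    (hu : u ≠ 0) : ∃ t : ℝ, o + t • u ∉ minCell l i := by
  by_contra! hline
  have happ : ∀ j p v (t : ℝ), l j (p + t • v) = l j p + t * (l j).linear v := by
    intro j p v t
    have := (l j).map_vadd p (t • v)
    simp only [vadd_eq_add, map_smul, smul_eq_mul] at this
    rw [add_comm p, this, add_comm]
  -- The difference of two forms is bounded below along the line, hence constant.
  have hslope : ∀ j, (l j).linear u = (l i).linear u := by
    intro j
    by_contra hne
    set d := (l j).linear u - (l i).linear u with hd
    have hd0 : d ≠ 0 := sub_ne_zero.2 hne
    have h1 := hline (-(l j o - l i o + 1) / d) j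
    rw [happ, happ] at h1
    have h2 : -(l j o - l i o + 1) / d * d = -(l j o - l i o + 1) := div_mul_cancel₀ _ hd0
    rw [hd, mul_sub] at h2
    linarith
  obtain ⟨v, hv, hv0⟩ : ∃ v : Plane, v ≠ 0 ∧ ∀ j, 0 ≤ (l j).linear v := by
    rcases le_total 0 ((l i).linear u) with hd | hd
    · exact ⟨u, hu, fun j => by rw [hslope]; exact hd⟩
    · exact ⟨-u, neg_ne_zero.2 hu, fun j => by rw [map_neg, hslope]; linarith⟩
  obtain ⟨t, ht, hmem⟩ := exists_notMem_polygonBody P (P i) hv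
  refine hmem (h.mem_body _ fun j => ?_)
  rw [happ]
  exact add_nonneg (h.nonneg_vertex j i) (mul_nonneg ht (hv0 j))

theorem isConvexPolygonalRegion_minCell (h : IsEdgeForms P l) (hs : 3 ≤ s) (i : Fin s) :
    IsConvexPolygonalRegion (minCell l i) := by
  refine ⟨?_, ⟨_, h.midpoint_mem_interior_minCell hs i⟩, ?_⟩
  · choose a c hac using fun j => (l i - l j).exists_inner_add_eq
    refine ⟨s, a, fun j => -c j, ?_⟩
    ext x
    refine forall_congr' fun j => ?_
    have := hac j x
    simp only [AffineMap.coe_sub, Pi.sub_apply] at this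
    constructor <;> intro h' <;> linarith
  · refine isPreconnected_frontier_of_no_line ?_ ?_ (h.midpoint_mem_interior_minCell hs i)
      fun u hu => h.exists_notMem_minCell i _ hu
    · rw [← Module.finrank_eq_rank]; simp
    · have : minCell l i = ⋂ j, (l j - l i) ⁻¹' Set.Ici 0 := by
        ext x; simp [minCell]
      rw [this]
      exact convex_iInter fun j => (convex_Ici (0 : ℝ)).affine_preimage _

theorem isPlanePartition_minCell (h : IsEdgeForms P l) (hs : 3 ≤ s) :
    IsPlanePartition (minCell l) := by
  refine ⟨Set.eq_univ_of_forall fun x => ?_, fun i j hij => ?_⟩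
  · obtain ⟨i, hi⟩ := Finite.exists_min fun i => l i x
    exact Set.mem_iUnion.2 ⟨i, hi⟩
  · rw [Set.disjoint_left]
    intro x hi hj
    exact lt_asymm (h.lt_of_mem_interior_minCell hs hij.symm hi)
      (h.lt_of_mem_interior_minCell hs hij hj)

theorem isDiagonal_minCell (h : IsEdgeForms P l) (hs : 3 ≤ s) (i : Fin s) :
    IsDiagonal (minCell l i) (P i) (P (i + 1)) := by
  obtain ⟨k, rfl⟩ := Fin.exists_add_one_eq i
  refine ⟨fun heq => ?_, ?_, ?_⟩
  · have := h.exists_pos hs k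
    rw [← heq, h.right] at this
    exact lt_irrefl _ this
  · refine mem_frontier_minCell (fun j => h.nonneg_vertex j _) (h.left _) (h.right k) (h.left k)
      (h.pos _ _ (Fin.add_one_ne_self (by omega) k).symm
        (Fin.add_one_add_one_ne_self hs k).symm)
  · exact mem_frontier_minCell (fun j => h.nonneg_vertex j _) (h.right _) (h.left _) (h.right _)
      (h.exists_pos hs _)

end IsEdgeForms

/-! ### The edge forms of a convex polygon -/

/-- The map `orient a b`, multiplied by `ε`, as an affine form. -/
def orientForm (ε : ℝ) (a b : Plane) : Plane →ᵃ[ℝ] ℝ where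
  toFun x := ε * orient a b x
  linear :=
    { toFun := fun v => ε * ((b 0 - a 0) * v 1 - (b 1 - a 1) * v 0)
      map_add' := fun v w => by simp; ring
      map_smul' := fun t v => by simp; ring }
  map_vadd' x v := by simp [orient]; ring

/-- The sign `ε` allows both orientations; the values of `orient`, divided by `orient a b c`, are
the barycentric coordinates of `x`. -/
theorem mem_convexHull_of_orient_nonneg {ε : ℝ} {a b c x : Plane} (habc : 0 < ε * orient a b c)
    (hab : 0 ≤ ε * orient a b x) (hbc : 0 ≤ ε * orient b c x) (hca : 0 ≤ ε * orient c a x) :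
    x ∈ convexHull ℝ {a, b, c} := by
  set D := ε * orient a b c with hD
  have hmem := (convex_convexHull ℝ {a, b, c}).sum_mem (t := Finset.univ)
    (w := ![ε * orient b c x / D, ε * orient c a x / D, ε * orient a b x / D]) (z := ![a, b, c])
    (by intro i _; fin_cases i <;> simp <;> positivity)
    (by
      rw [Fin.sum_univ_three]
      simp only [Matrix.cons_val]
      rw [← add_div, ← add_div, div_eq_one_iff_eq habc.ne', hD]
      simp only [orient]; ring)
    (by intro i _; apply subset_convexHull; fin_cases i <;> simp)
  convert hmem using 1
  rw [Fin.sum_univ_three]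
  ext i
  simp only [Matrix.cons_val, PiLp.add_apply, PiLp.smul_apply, smul_eq_mul]
  field_simp
  rw [hD]
  fin_cases i <;> simp [orient] <;> ring

/-- The body is the intersection of the half-planes of its edges: a point of all of them lies in
one of the triangles of the fan at `P 0`. -/
theorem isEdgeForms_orientForm {s : ℕ} [NeZero s] {P : Polygon Plane s} (hs : 3 ≤ s) {ε : ℝ}
    (hP : ∀ i j : Fin s, j ≠ i → j ≠ i + 1 → 0 < ε * orient (P i) (P (i + 1)) (P j)) :
    IsEdgeForms P fun i => orientForm ε (P i) (P (i + 1)) where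
  left i := by simp [orientForm, orient]
  right i := by simp [orientForm, orient]; right; ring
  pos i j h1 h2 := hP i j h1 h2
  mem_body x hx := by
    replace hx : ∀ i, 0 ≤ ε * orient (P i) (P (i + 1)) x := hx
    let q : ℕ → Fin s := Fin.ofNat s
    have hq : ∀ k, k + 1 < s → q (k + 1) = q k + 1 := by
      intro k hk
      apply Fin.ext
      rw [Fin.val_add_one_eq_ite (by omega)]
      simp only [q, Fin.val_ofNat, Nat.mod_eq_of_lt hk, Nat.mod_eq_of_lt (show k < s by omega)]
      split_ifs <;> omega
    -- Walking along the fan of triangles at the first vertex, some triangle contains `x`.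
    obtain ⟨k, hk1, hk2, hk3, hk4⟩ : ∃ k, 1 ≤ k ∧ k + 1 < s ∧
        0 ≤ ε * orient (P 0) (P (q k)) x ∧ ε * orient (P 0) (P (q (k + 1))) x ≤ 0 := by
      by_contra! hno
      have hstep : ∀ k, k + 2 < s → 0 < ε * orient (P 0) (P (q (k + 2))) x := by
        intro k
        induction k with
        | zero =>
          intro hk
          refine hno 1 le_rfl hk ?_
          have := hx 0
          rw [show q 1 = 0 + 1 by rw [hq 0 (by omega)]; rfl]
          exact this
        | succ k ih => exact fun hk => hno (k + 2) (by omega) hk (ih (by omega)).le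
      have h1 := hstep (s - 3) (by omega)
      have h2 := hx (q (s - 3 + 2))
      rw [show q (s - 3 + 2) + 1 = 0 by
        apply Fin.ext
        rw [Fin.val_add_one_eq_ite (by omega)]
        simp only [q, Fin.val_ofNat, Nat.mod_eq_of_lt (show s - 3 + 2 < s by omega)]
        rw [if_pos (by omega)]; rfl] at h2
      have h3 : orient (P (q (s - 3 + 2))) (P 0) x = -orient (P 0) (P (q (s - 3 + 2))) x := by
        simp only [orient]; ring
      rw [h3] at h2
      linarith
    have hkv : (q k).val = k := Nat.mod_eq_of_lt (by omega)
    have hkv' : (q (k + 1)).val = k + 1 := Nat.mod_eq_of_lt hk2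
    have hpos := hP (q k) 0 (fun h => by rw [← h] at hkv; simp at hkv; omega)
      (fun h => by rw [← hq k hk2] at h; rw [← h] at hkv'; simp at hkv')
    have hmid := hx (q k)
    rw [← hq k hk2] at hpos hmid
    have hmem : x ∈ convexHull ℝ {P 0, P (q k), P (q (k + 1))} := by
      refine mem_convexHull_of_orient_nonneg (ε := ε) ?_ hk3 hmid ?_
      · convert hpos using 2; simp only [orient]; ring
      · have : orient (P (q (k + 1))) (P 0) x = -orient (P 0) (P (q (k + 1))) x := by
          simp only [orient]; ring
        rw [this]; linarith
    refine convexHull_mono ?_ hmem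
    rintro y (rfl | rfl | rfl) <;> exact Set.mem_range_self _

theorem IsConvexPolygon.exists_isEdgeForms {s : ℕ} [NeZero s] {P : Polygon Plane s}
    (hP : IsConvexPolygon P) : ∃ l, IsEdgeForms P l := by
  obtain ⟨hs, h | h⟩ := hP
  · exact ⟨_, isEdgeForms_orientForm (ε := -1) hs fun i j h1 h2 => by linarith [h i j h1 h2]⟩
  · exact ⟨_, isEdgeForms_orientForm (ε := 1) hs fun i j h1 h2 => by linarith [h i j h1 h2]⟩

/-! ### The partition -/

theorem theorem3 (s : ℕ) [NeZero s] (P : Polygon Plane s) (hP : IsConvexPolygon P)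
    (B R : Finset Plane)
    (hB : ∀ x ∈ B, x ∈ interior (polygonBody P))
    (hR : ∀ x ∈ R, x ∉ polygonBody P)
    (hs : (s : ℤ) = (B.card : ℤ) - (R.card : ℤ))
    (hgen : InGeneralPosition ((R : Set Plane) ∪ (B : Set Plane) ∪ Set.range P.vertices)) :
    ∃ Q : Fin s → Set Plane,
      (∀ i, IsConvexPolygonalRegion (Q i)) ∧
      IsPlanePartition Q ∧
      (∀ i, IsDiagonal (Q i) (P i) (P (i + 1))) ∧
      ∃ part : Plane → Fin s,
        (∀ x, x ∈ B ∨ x ∈ R → x ∈ Q (part x)) ∧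
        ∀ i, ((B.filter (fun x => part x = i)).card : ℤ)
          - ((R.filter (fun x => part x = i)).card : ℤ) = 1 := by
  classical
  have h3 : 3 ≤ s := hP.1
  obtain ⟨l, hl⟩ := hP.exists_isEdgeForms
  obtain ⟨w, f, g, hw, hf, hg, hcount⟩ := exists_signed_allocation (ι := Fin s) (β := B) (ρ := R)
    (by simp only [Fintype.card_coe, Fintype.card_fin]; omega)
    (fun b i => l i b) (fun b i => hl.pos_of_mem_interior h3 i (hB b b.2))
    (fun r i => l i r) (fun r => by
      by_contra! h
      exact hR r r.2 (hl.mem_body _ h))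
  have hwl := hl.smul hw
  let part : Plane → Fin s := fun x =>
    if hx : x ∈ B then f ⟨x, hx⟩ else if hx : x ∈ R then g ⟨x, hx⟩ else 0
  have hdisj : ∀ x ∈ R, x ∉ B := fun x hxR hxB => hR x hxR (interior_subset (hB x hxB))
  have hpB : ∀ x : B, part x = f x := fun x => dif_pos x.2
  have hpR : ∀ x : R, part x = g x := fun x => by
    simp only [part, dif_neg (hdisj x x.2), dif_pos x.2]
  refine ⟨minCell fun i => w i • l i, hwl.isConvexPolygonalRegion_minCell h3,
    hwl.isPlanePartition_minCell h3, hwl.isDiagonal_minCell h3, part, ?_, fun i => ?_⟩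
  · rintro x (hx | hx) j
    · rw [hpB ⟨x, hx⟩]; exact hf ⟨x, hx⟩ j
    · rw [hpR ⟨x, hx⟩]; exact hg ⟨x, hx⟩ j
  · have key : ∀ (S : Finset Plane) (k : S → Fin s), (∀ x : S, part x = k x) →
        (S.filter fun x => part x = i).card = Fintype.card {x // k x = i} := by
      intro S k hk
      rw [← Fintype.card_coe]
      refine Fintype.card_congr
        { toFun := fun x => ⟨⟨x, (Finset.mem_filter.1 x.2).1⟩, by
            rw [← hk]; exact (Finset.mem_filter.1 x.2).2⟩
          invFun := fun x => ⟨x.1, Finset.mem_filter.2 ⟨x.1.2, by rw [hk]; exact x.2⟩⟩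
          left_inv := fun _ => rfl
          right_inv := fun _ => rfl }
    rw [key B f hpB, key R g hpR, hcount i]
    push_cast; ring
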